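/- Let $X$ be a complex Banach space and let $E,A$ be bounded linear operators on $X$ such that the pencil $sE-A$ is regular, i.e. $sE-A$ is bijective for at least one $s\in\mathbb C$. Let the Wong subspaces $R_k\subset X$ be defined by $R_0=X$ and $R_{k+1}=A^{-1}(ER_k)=\{x\in X: Ax\in ER_k\}$ for $k=0,1,2,\dots$. Then $R_k$ is closed in $X$ for every $k\ge 0$ in each of the following two cases: (a) $E$ is upper semi-Fredholm, i.e. $\dim\ker E<\infty$ and $\operatorname{ran}E$ is closed in $X$. (b) $\mu E-A$ is compact for some $\mu\in\mathbb C$. -/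

import Mathlib

section WongDefs

variable {X : Type*} [NormedAddCommGroup X] [NormedSpace ℂ X]

/-- The resolvent set `ρ(E, A)` of the operator pencil `sE - A` with bounded coefficients: all
complex `s` for which `sE - A : X → X` is bijective. -/
def pencilResolventSet (E A : X →L[ℂ] X) : Set ℂ :=
  {s : ℂ | Function.Bijective (s • E - A)}

/-- The pencil `sE - A` is regular if its resolvent set is nonempty. -/
def IsRegularPencil (E A : X →L[ℂ] X) : Prop :=
  (pencilResolventSet E A).Nonempty

/-- The descending Wong sequence of the pencil `sE - A`: `R₀ = X` and `Rₖ₊₁ = A⁻¹(E Rₖ)`,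
where `A⁻¹` denotes the preimage under `A` and `E Rₖ` the image under `E`. -/
def wongR (E A : X →L[ℂ] X) : ℕ → Submodule ℂ X
  | 0 => ⊤
  | k + 1 => ((wongR E A k).map (E : X →ₗ[ℂ] X)).comap (A : X →ₗ[ℂ] X)

/-- A bounded operator `T` is upper semi-Fredholm if its kernel is finite-dimensional and its
range is closed. -/
def IsUpperSemiFredholm (T : X →L[ℂ] X) : Prop :=
  FiniteDimensional ℂ (LinearMap.ker (T : X →ₗ[ℂ] X)) ∧ IsClosed (Set.range T)

end WongDefs

open Filter Topology

/-! An upper semi-Fredholm `E` preserves closedness of subspaces, so by induction `E Rₖ` and its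
preimage under `A` are closed. Case (b) reduces to (a): with `J = sE - A` bijective and `s ≠ μ`, `(s
- μ)E = J(1 - J⁻¹(μE - A))` is an isomorphism times a compact perturbation of the identity, so Riesz
theory applies. -/

/-- An upper semi-Fredholm operator on a Banach space maps closed subspaces to closed
subspaces. -/
theorem IsUpperSemiFredholm.isClosed_map {X : Type*} [NormedAddCommGroup X] [NormedSpace ℂ X]
    [CompleteSpace X] {T : X →L[ℂ] X} (hT : IsUpperSemiFredholm T) {M : Submodule ℂ X}
    (hM : IsClosed (M : Set X)) :
    IsClosed ((M.map (T : X →ₗ[ℂ] X) : Submodule ℂ X) : Set X) := by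
  obtain ⟨hker, hran⟩ := hT
  have hran' : IsClosed (LinearMap.range (T : X →ₗ[ℂ] X) : Set X) := hran
  have : CompleteSpace (LinearMap.range (T : X →ₗ[ℂ] X)) := hran'.completeSpace_coe
  -- Onto its complete range, `T` is a quotient map (open mapping), so it suffices that `T⁻¹(T M) =
  -- M + ker T` is closed.
  let Q : X →L[ℂ] LinearMap.range (T : X →ₗ[ℂ] X) :=
    T.codRestrict _ fun x ↦ LinearMap.mem_range_self (T : X →ₗ[ℂ] X) x
  have hQ : Function.Surjective Q := by
    rintro ⟨_, x, rfl⟩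
    exact ⟨x, rfl⟩
  have hpre : Q ⁻¹' (Subtype.val ⁻¹' (M.map (T : X →ₗ[ℂ] X) : Set X)) =
      ((M ⊔ LinearMap.ker (T : X →ₗ[ℂ] X) : Submodule ℂ X) : Set X) := by
    rw [← Submodule.comap_map_eq]
    rfl
  have hclosed : IsClosed (Subtype.val ⁻¹' (M.map (T : X →ₗ[ℂ] X) : Set X) :
      Set (LinearMap.range (T : X →ₗ[ℂ] X))) := by
    rw [← (Q.isQuotientMap hQ).isClosed_preimage, hpre]
    exact Submodule.isClosed_sup_finiteDimensional _ _ hM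
  have himage := hran'.isClosedEmbedding_subtypeVal.isClosedMap _ hclosed
  convert himage using 1
  refine (Set.image_preimage_eq_iff.mpr ?_).symm
  rw [Subtype.range_coe]
  exact LinearMap.map_le_range

/-- If `E` is upper semi-Fredholm, all terms of the Wong sequence are closed. -/
theorem IsUpperSemiFredholm.isClosed_wongR {X : Type*} [NormedAddCommGroup X] [NormedSpace ℂ X]
    [CompleteSpace X] {E : X →L[ℂ] X} (hE : IsUpperSemiFredholm E) (A : X →L[ℂ] X) (k : ℕ) :
    IsClosed (wongR E A k : Set X) := by
  induction k with
  | zero => exact isClosed_univ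
  | succ k ih => exact (hE.isClosed_map ih).preimage A.continuous

/-- On a closed subspace that meets the kernel of `1 - K` trivially, `1 - K` is bounded below
whenever `K` is compact. -/
theorem IsCompactOperator.exists_antilipschitz_one_sub_domRestrict {X : Type*}
    [NormedAddCommGroup X] [NormedSpace ℂ X] {K : X →L[ℂ] X} (hK : IsCompactOperator K)
    {M : Submodule ℂ X} (hM : IsClosed (M : Set X)) (hker : ∀ x ∈ M, K x = x → x = 0) :
    ∃ C, AntilipschitzWith C ((1 - K : X →L[ℂ] X).domRestrict M) := by
  rw [antilipschitzWith_iff_exists_mul_le_norm]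
  by_contra! h
  have hseq (n : ℕ) : ∃ x ∈ M, ‖x‖ = 1 ∧ ‖x - K x‖ < 1 / ((n : ℝ) + 1) := by
    obtain ⟨⟨x, hxM⟩, hx⟩ := h (1 / ((n : ℝ) + 1)) (by positivity)
    replace hx : ‖x - K x‖ < 1 / ((n : ℝ) + 1) * ‖x‖ := hx
    have hx0 : 0 < ‖x‖ := by
      refine norm_pos_iff.mpr ?_
      rintro rfl
      simp at hx
    refine ⟨((‖x‖⁻¹ : ℝ) : ℂ) • x, M.smul_mem _ hxM, ?_, ?_⟩
    · simp [norm_smul, hx0.ne']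
    · rw [map_smul, ← smul_sub, norm_smul, Complex.norm_real, norm_inv, norm_norm,
        inv_mul_lt_iff₀ hx0, mul_comm]
      exact hx
  choose x hxM hx1 hx using hseq
  have hlim : Tendsto (fun n ↦ x n - K (x n)) atTop (𝓝 0) :=
    squeeze_zero_norm (fun n ↦ (hx n).le) tendsto_one_div_add_atTop_nhds_zero_nat
  obtain ⟨S, hS, hS'⟩ := hK.image_closedBall_subset_compact 1
  -- Along `φ`, `x = (x - K x) + K x` converges, giving a unit fixed vector of `K` in `M`.
  obtain ⟨y, -, φ, hφ, hy⟩ := hS.tendsto_subseq (x := fun n ↦ K (x n))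
    fun n ↦ hS' ⟨x n, by simp [hx1], rfl⟩
  have hxy : Tendsto (x ∘ φ) atTop (𝓝 y) := by
    simpa [Function.comp_def] using (hlim.comp hφ.tendsto_atTop).add hy
  have hyM : y ∈ M := hM.mem_of_tendsto hxy (Eventually.of_forall fun n ↦ hxM _)
  have hKy : K y = y := tendsto_nhds_unique ((K.continuous.tendsto y).comp hxy) hy
  have hy1 : ‖y‖ = 1 := tendsto_nhds_unique hxy.norm (by simp [hx1])
  simp [hker y hyM hKy] at hy1

/-- Riesz: a compact perturbation of the identity is upper semi-Fredholm. -/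
theorem IsCompactOperator.isUpperSemiFredholm_one_sub {X : Type*} [NormedAddCommGroup X]
    [NormedSpace ℂ X] [CompleteSpace X] {K : X →L[ℂ] X} (hK : IsCompactOperator K) :
    IsUpperSemiFredholm (1 - K) := by
  have hmem {x : X} : x ∈ LinearMap.ker ((1 - K : X →L[ℂ] X) : X →ₗ[ℂ] X) ↔ K x = x := by
    rw [LinearMap.mem_ker]
    exact sub_eq_zero.trans eq_comm
  have hfin : FiniteDimensional ℂ (LinearMap.ker ((1 - K : X →L[ℂ] X) : X →ₗ[ℂ] X)) := by
    -- `K` is the identity on this kernel.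
    refine .of_isCompactOperator_id ?_
    have hmaps : ∀ x ∈ LinearMap.ker ((1 - K : X →L[ℂ] X) : X →ₗ[ℂ] X),
        (K : X →ₗ[ℂ] X) x ∈ LinearMap.ker ((1 - K : X →L[ℂ] X) : X →ₗ[ℂ] X) := fun x hx ↦ by
      rw [ContinuousLinearMap.coe_coe, hmem.mp hx]
      exact hx
    have hres := IsCompactOperator.restrict (f := (K : X →ₗ[ℂ] X)) hK hmaps
      (1 - K : X →L[ℂ] X).isClosed_ker
    have hid : ⇑((K : X →ₗ[ℂ] X).restrict hmaps) = id :=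
      funext fun x ↦ Subtype.ext (hmem.mp x.2)
    rwa [hid] at hres
  refine ⟨hfin, ?_⟩
  -- On a closed complement of the kernel, `1 - K` keeps its full range and is bounded below.
  obtain ⟨M, hM, hcompl⟩ :=
    (Submodule.ClosedComplemented.of_finiteDimensional
      (LinearMap.ker ((1 - K : X →L[ℂ] X) : X →ₗ[ℂ] X))).exists_isClosed_isCompl
  obtain ⟨C, hC⟩ := hK.exists_antilipschitz_one_sub_domRestrict hM fun x hx hKx ↦
    Submodule.disjoint_def.mp hcompl.disjoint x (hmem.mpr hKx) hx
  have : CompleteSpace M := hM.completeSpace_coe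
  convert hC.isClosed_range (ContinuousLinearMap.uniformContinuous _) using 1
  refine subset_antisymm ?_ ?_
  · rintro _ ⟨x, rfl⟩
    obtain ⟨u, hu, v, hv, rfl⟩ :=
      Submodule.mem_sup.mp (hcompl.sup_eq_top ▸ Submodule.mem_top (x := x))
    refine ⟨⟨v, hv⟩, ?_⟩
    have hu0 : (1 - K : X →L[ℂ] X) u = 0 := hu
    rw [map_add, hu0, zero_add]
    rfl
  · rintro _ ⟨x, rfl⟩
    exact ⟨x, rfl⟩

/-- Composing an upper semi-Fredholm operator with an isomorphism on the left gives an upper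
semi-Fredholm operator. -/
theorem IsUpperSemiFredholm.equiv_comp {X : Type*} [NormedAddCommGroup X] [NormedSpace ℂ X]
    {T : X →L[ℂ] X} (hT : IsUpperSemiFredholm T) (J : X ≃L[ℂ] X) :
    IsUpperSemiFredholm ((J : X →L[ℂ] X) ∘L T) := by
  refine ⟨?_, ?_⟩
  · have hker : LinearMap.ker (((J : X →L[ℂ] X) ∘L T : X →L[ℂ] X) : X →ₗ[ℂ] X) =
        LinearMap.ker (T : X →ₗ[ℂ] X) := by
      ext x
      simp
    rw [hker]
    exact hT.1
  · have hrange : Set.range ((J : X →L[ℂ] X) ∘L T) = J '' Set.range T := by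
      rw [← Set.range_comp]
      rfl
    rw [hrange]
    exact J.toHomeomorph.isClosedMap _ hT.2

/-- A nonzero multiple of an upper semi-Fredholm operator determines an upper semi-Fredholm
operator. -/
theorem IsUpperSemiFredholm.of_smul {X : Type*} [NormedAddCommGroup X] [NormedSpace ℂ X]
    {T : X →L[ℂ] X} {c : ℂ} (hc : c ≠ 0) (hT : IsUpperSemiFredholm (c • T)) :
    IsUpperSemiFredholm T := by
  convert hT.equiv_comp (ContinuousLinearEquiv.smulLeft (Units.mk0 c hc)).symm using 1
  ext x
  exact ((ContinuousLinearEquiv.smulLeft (Units.mk0 c hc)).symm_apply_apply (T x)).symm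

/-- For a regular pencil such that `μ E - A` is compact for some `μ`, the operator `E` is upper
semi-Fredholm. -/
theorem IsRegularPencil.isUpperSemiFredholm_of_isCompactOperator {X : Type*}
    [NormedAddCommGroup X] [NormedSpace ℂ X] [CompleteSpace X] {E A : X →L[ℂ] X}
    (hreg : IsRegularPencil E A) {μ : ℂ} (hμ : IsCompactOperator (μ • E - A)) :
    IsUpperSemiFredholm E := by
  obtain ⟨s, hs⟩ := hreg
  let J : X ≃L[ℂ] X := ContinuousLinearEquiv.ofBijective (s • E - A)
    (LinearMap.ker_eq_bot.mpr hs.1) (LinearMap.range_eq_top.mpr hs.2)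
  have hJ (x : X) : J x = (s • E - A) x := rfl
  have hcomp : IsCompactOperator ((J.symm : X →L[ℂ] X) ∘L (μ • E - A)) :=
    hμ.clm_comp (J.symm : X →L[ℂ] X)
  by_cases hsμ : s = μ
  -- Here `J` itself is compact, hence so is `J⁻¹J = 1`.
  · subst hsμ
    have : FiniteDimensional ℂ X := by
      refine .of_isCompactOperator_id ?_
      convert hcomp using 1
      ext x
      exact (J.symm_apply_apply x).symm
    refine ⟨inferInstance, ?_⟩
    exact (LinearMap.range (E : X →ₗ[ℂ] X)).closed_of_finiteDimensional
  · refine IsUpperSemiFredholm.of_smul (sub_ne_zero.mpr hsμ) ?_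
    convert hcomp.isUpperSemiFredholm_one_sub.equiv_comp J using 1
    ext x
    have hx : J (x - J.symm ((μ • E - A) x)) = (s • E - A) x - (μ • E - A) x := by
      rw [map_sub, J.apply_symm_apply, hJ]
    refine Eq.trans ?_ hx.symm
    change (s - μ) • E x = (s • E x - A x) - (μ • E x - A x)
    rw [sub_smul]
    abel

theorem mainTheorem10 {X : Type*} [NormedAddCommGroup X] [NormedSpace ℂ X] [CompleteSpace X]
    (E A : X →L[ℂ] X) (hreg : IsRegularPencil E A) :
    (IsUpperSemiFredholm E → ∀ k : ℕ, IsClosed (wongR E A k : Set X)) ∧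
    ((∃ μ : ℂ, IsCompactOperator (μ • E - A)) →
      ∀ k : ℕ, IsClosed (wongR E A k : Set X)) :=
  ⟨fun hE k ↦ hE.isClosed_wongR A k, fun ⟨_, hμ⟩ k ↦
    (hreg.isUpperSemiFredholm_of_isCompactOperator hμ).isClosed_wongR A k⟩
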